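/- Consider a trial-offer market with $N$ items, $N$ positions of visibilities $v_1\ge v_2\ge\dots\ge v_N>0$, and $K$ consumer classes with weights $w_k>0$, $\sum_k w_k=1$; item $i$ has appeal $a_{i,k}\ge 0$ and quality $q_{i,k}\in[0,1]$ for class $k$. Consumers arrive one at a time, each belonging to class $k$ with probability $w_k$. If the ranking is the permutation $\sigma$ (item $i$ stands in position $\sigma(i)$) and the displayed popularity vector is $d\in\mathbb N^N$, a consumer of class $k$ tries item $i$ with probability $$p_{i,k}(\sigma,d)=\frac{v_{\sigma(i)}(a_{i,k}+d_i)}{\sum_{j} v_{\sigma(j)}(a_{j,k}+d_j)+z},\qquad z\ge 0,$$ and then buys it with probability $q_{i,k}$. Let $\bar q_i=\sum_k w_kq_{i,k}$, and let $\sigma$ be an average quality ranking, that is, a static ranking by decreasing $\bar q_i$ (ties in any order). With the popularity signal, $d$ is the vector of past purchases, initially $0$; let $P_{AQGSI}$ be the limit, as $t\to\infty$, of the probability that the $t$-th consumer makes a purchase. Without the signal $d$ is replaced by $0$, and the purchase probability is $P_{AQNSI}=\sum_k w_k\sum_i p_{i,k}(\sigma,0)\,q_{i,k}$. Proposition. The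 bounds $0$ and $K$ in $0\le P_{AQNSI}/P_{AQGSI}\le K$ are tight. Precisely, let $K=N\ge 1$, $z=0$, $w_k=1/K$ for all $k$, let $v_1\ge\dots\ge v_K>0$ be arbitrary, and for $0<\epsilon<1$ let the quality matrix be diagonal with first diagonal entry $1$ and all other diagonal entries $1-\epsilon$. 1. If the appeal matrix is the identity, then for every $\epsilon\in(0,1)$ and every average quality ranking the limit $P_{AQGSI}$ exists, is positive and equals $\max_i\bar q_i$, and for every choice of average quality rankings $$\lim_{\epsilon\to0^+}\frac{P_{AQNSI}}{P_{AQGSI}}=K.$$ The value $K$ is also approached by strictly positive appeals: for every $r<K$ there are $\epsilon\in(0,1)$ and a matrix of strictly positive appeals such that, for every average quality ranking, the limit $P_{AQGSI}$ exists, is positive and equals $\max_i\bar q_i$, and $P_{AQNSI}/P_{AQGSI}>r$. 2. If $K\ge2$, $\epsilon\in(0,1)$ is fixed, and the appeal matrix has all diagonal entries equal to $\epsilon_A>0$ and all other entries equal to $1$, then for every $\epsilon_A>0$ and every average quality ranking the limit $P_{AQGSI}$ exists, is positive and equals $\max_i\bar q_i$, and for every choice of average quality rankings $$\lim_{\epsilon_A\to0^+}\frac{P_{AQNSI}}{P_{AQGSI}}=0.$$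 -/

import Mathlib

/-!
The sales vector `d` is a Markov chain. Suppose that, per unit of `d + α`, item `j` is bought at
most `θ < 1` times as often as item `o`. With `x = d j + α` and `y = d o + α`, the quantity
`x ^ s * Γ (y - θ * s) / Γ y` is then a nonnegative supermartingale: a purchase of `o` multiplies it
by exactly `1 - θ * s / y`, one of `j` by at most `1 + s / x`. It dominates `x ^ s / y ^ (θ * s)`,
hence `n ^ ((1 - θ) * s)` times the share `x / n` of `j` among all sales. As total sales tend to
infinity, the share of `j` vanishes in mean; when this holds for every `j ≠ o`, all trials
eventually go to `o`, and the purchase probability tends to the average quality of `o`.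

In the diagonal markets the first item outgrows every other one with `θ = 1 - ε`. The ratio of the
two purchase probabilities is then an explicit rational function of the parameters, whose limits
are uniform over the finitely many rankings.
-/

open Filter Topology

/-- The parameters of a trial-offer market with `N` items (equivalently `N` positions) and `K`
consumer classes: visibilities `v j` of the positions, appeals `a i k` and qualities `q i k` of
item `i` for class `k`, class weights `w k` (the probability that an arriving consumer belongs to
class `k`), and the constant `z` of the no-trial option. -/
structure Market (N K : ℕ) where
  v : Fin N → ℝ
  a : Fin N → Fin K → ℝ
  q : Fin N → Fin K → ℝ
  w : Fin K → ℝ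
  z : ℝ

namespace Market

variable {N K : ℕ}

/-- The parameters form a mixed multinomial logit model. Positions are sorted by visibility.
Appeals are allowed to vanish here; strict positivity is `PositiveAppeals`. -/
structure IsMMNL (M : Market N K) : Prop where
  v_nonneg : ∀ j, 0 ≤ M.v j
  v_antitone : Antitone M.v
  a_nonneg : ∀ i k, 0 ≤ M.a i k
  q_nonneg : ∀ i k, 0 ≤ M.q i k
  q_le_one : ∀ i k, M.q i k ≤ 1
  w_pos : ∀ k, 0 < M.w k
  w_sum : ∑ k, M.w k = 1
  z_nonneg : 0 ≤ M.z

/-- All appeals are strictly positive. -/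
def PositiveAppeals (M : Market N K) : Prop := ∀ i k, 0 < M.a i k

/-- The probability that a consumer of class `k` tries item `i` when item `j` stands in position
`σ j` and the displayed popularity vector is `d`. -/
noncomputable def tryProb (M : Market N K) (σ : Equiv.Perm (Fin N)) (d : Fin N → ℕ)
    (i : Fin N) (k : Fin K) : ℝ :=
  M.v (σ i) * (M.a i k + d i) / (∑ j, M.v (σ j) * (M.a j k + d j) + M.z)

/-- The probability that the next consumer, of a random class, buys item `i` when the displayed
popularity vector is `d`. -/
noncomputable def buyProb (M : Market N K) (σ : Equiv.Perm (Fin N)) (d : Fin N → ℕ)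
    (i : Fin N) : ℝ :=
  ∑ k, M.w k * (M.tryProb σ d i k * M.q i k)

theorem tryProb_nonneg {M : Market N K} (h : M.IsMMNL) (σ : Equiv.Perm (Fin N))
    (d : Fin N → ℕ) (i : Fin N) (k : Fin K) : 0 ≤ M.tryProb σ d i k := by
  have key : ∀ j, 0 ≤ M.v (σ j) * (M.a j k + d j) := fun j =>
    mul_nonneg (h.v_nonneg _) (add_nonneg (h.a_nonneg _ _) (Nat.cast_nonneg _))
  exact div_nonneg (key i) (add_nonneg (Finset.sum_nonneg fun j _ => key j) h.z_nonneg)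

theorem sum_tryProb_le_one {M : Market N K} (h : M.IsMMNL) (σ : Equiv.Perm (Fin N))
    (d : Fin N → ℕ) (k : Fin K) : ∑ i, M.tryProb σ d i k ≤ 1 := by
  have key : ∀ j, 0 ≤ M.v (σ j) * (M.a j k + d j) := fun j =>
    mul_nonneg (h.v_nonneg _) (add_nonneg (h.a_nonneg _ _) (Nat.cast_nonneg _))
  have hs := Finset.sum_nonneg fun j (_ : j ∈ Finset.univ) => key j
  simp only [tryProb]
  rw [← Finset.sum_div]
  exact div_le_one_of_le₀ (by linarith [h.z_nonneg]) (add_nonneg hs h.z_nonneg)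

theorem buyProb_nonneg {M : Market N K} (h : M.IsMMNL) (σ : Equiv.Perm (Fin N))
    (d : Fin N → ℕ) (i : Fin N) : 0 ≤ M.buyProb σ d i :=
  Finset.sum_nonneg fun k _ => mul_nonneg (h.w_pos k).le
    (mul_nonneg (tryProb_nonneg h σ d i k) (h.q_nonneg i k))

theorem sum_buyProb_le_one {M : Market N K} (h : M.IsMMNL) (σ : Equiv.Perm (Fin N))
    (d : Fin N → ℕ) : ∑ i, M.buyProb σ d i ≤ 1 := by
  simp only [buyProb]
  rw [Finset.sum_comm, ← h.w_sum]
  refine Finset.sum_le_sum fun k _ => ?_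
  rw [← Finset.mul_sum]
  refine mul_le_of_le_one_right (h.w_pos k).le (le_trans (Finset.sum_le_sum fun i _ => ?_)
    (sum_tryProb_le_one h σ d k))
  exact mul_le_of_le_one_right (tryProb_nonneg h σ d i k) (h.q_le_one i k)

/-- The law of the decision of the next consumer when the displayed popularity vector is `d`:
`some i` means that item `i` is bought, `none` that nothing is bought. -/
noncomputable def outcome (M : Market N K) (h : M.IsMMNL) (σ : Equiv.Perm (Fin N))
    (d : Fin N → ℕ) : PMF (Option (Fin N)) :=
  PMF.ofFintype
    (fun o => ENNReal.ofReal (o.elim (1 - ∑ i, M.buyProb σ d i) fun i => M.buyProb σ d i))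
    (by
      rw [Fintype.sum_option, Option.elim_none]
      simp only [Option.elim_some]
      rw [← ENNReal.ofReal_sum_of_nonneg fun i _ => buyProb_nonneg h σ d i,
        ← ENNReal.ofReal_add (sub_nonneg.2 (sum_buyProb_le_one h σ d))
          (Finset.sum_nonneg fun i _ => buyProb_nonneg h σ d i)]
      simp)

/-- The law of the sales vector after `t` consumers when the ranking `σ` is always used and every
consumer is shown the current sales vector. Sales start from zero. -/
noncomputable def sales (M : Market N K) (h : M.IsMMNL) (σ : Equiv.Perm (Fin N)) :
    ℕ → PMF (Fin N → ℕ)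
  | 0 => PMF.pure 0
  | t + 1 => (M.sales h σ t).bind fun d =>
      (M.outcome h σ d).map fun o => o.elim d fun i => d + Pi.single i 1

/-- The probability that the consumer who arrives after `t` others buys an item, when the ranking
`σ` is always used and the popularity signal is shown. -/
noncomputable def signalPurchaseProb (M : Market N K) (h : M.IsMMNL) (σ : Equiv.Perm (Fin N))
    (t : ℕ) : ℝ :=
  ∑ i, (((M.sales h σ t).bind (M.outcome h σ)) (some i)).toReal

/-- The probability that a consumer buys an item when the popularity signal is not used, that is,
when the popularity vector is replaced by zero. -/
noncomputable def noSignalPurchaseProb (M : Market N K) (σ : Equiv.Perm (Fin N)) : ℝ :=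
  ∑ i, M.buyProb σ 0 i

/-- The weighted average quality of item `i`. -/
noncomputable def avgQuality (M : Market N K) (i : Fin N) : ℝ := ∑ k, M.w k * M.q i k

/-- The highest weighted average quality of an item. -/
noncomputable def maxAvgQuality (M : Market N K) : ℝ := ⨆ i, M.avgQuality i

/-- `σ` lists the items in decreasing order of weighted average quality (ties in any order). -/
def IsAvgQualityRanking (M : Market N K) (σ : Equiv.Perm (Fin N)) : Prop :=
  ∀ i j, σ i < σ j → M.avgQuality j ≤ M.avgQuality i

/-- `L` is the limiting purchase probability of the static ranking `σ` with the
popularity signal. -/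
def HasSignalLimit (M : Market N K) (h : M.IsMMNL) (σ : Equiv.Perm (Fin N)) (L : ℝ) : Prop :=
  Tendsto (fun t => M.signalPurchaseProb h σ t) atTop (𝓝 L)

/-- The market with `K` items and `K` classes, visibilities `v`, appeals `a`, equal weights,
`z = 0`, and the diagonal quality matrix with first entry `1` and other entries `1 - ε`. -/
noncomputable def diagonal (v : Fin K → ℝ) (ε : ℝ) (a : Fin K → Fin K → ℝ) : Market K K where
  v := v
  a := a
  q := fun i k => if i = k then (if i.val = 0 then 1 else 1 - ε) else 0
  w := fun _ => 1 / (K : ℝ)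
  z := 0

/-- The identity appeal matrix. -/
def idAppeal (K : ℕ) : Fin K → Fin K → ℝ := fun i k => if i = k then 1 else 0

/-- The appeal matrix with diagonal entries `α` and all other entries `1`. -/
def smallDiagAppeal (K : ℕ) (α : ℝ) : Fin K → Fin K → ℝ := fun i k => if i = k then α else 1

end Market

theorem tsum_bind_apply_mul {α β : Type*} (p : PMF α) (f : α → PMF β) (g : β → ENNReal) :
    ∑' b, p.bind f b * g b = ∑' a, p a * ∑' b, f a b * g b := by
  simp only [PMF.bind_apply, ← ENNReal.tsum_mul_right, ← ENNReal.tsum_mul_left, mul_assoc]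
  exact ENNReal.tsum_comm

theorem tsum_map_apply_mul {α β : Type*} (p : PMF α) (f : α → β) (g : β → ENNReal) :
    ∑' b, p.map f b * g b = ∑' a, p a * g (f a) := by
  rw [← PMF.bind_pure_comp, tsum_bind_apply_mul]
  simp only [Function.comp_apply, PMF.pure_apply, ite_mul, one_mul, zero_mul, tsum_ite_eq]

theorem tendsto_apply_of_forall_tendsto {ι X Y : Type*} [Finite ι] {l : Filter X} {l' : Filter Y}
    {f : X → ι → Y} (hf : ∀ i, Tendsto (fun x => f x i) l l') (g : X → ι) :
    Tendsto (fun x => f x (g x)) l l' := fun s hs => by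
  have hall : ∀ᶠ x in l, ∀ i, f x i ∈ s := eventually_all.2 fun i => hf i hs
  exact hall.mono fun x hx => hx (g x)

theorem add_le_one_add_div_mul_add {x y t : ℝ} (hx : 0 ≤ x) (hy : 0 < y) (ht : 0 ≤ t) :
    x + t ≤ (1 + x / y) * (y + t) := by
  have hexpand : (1 + x / y) * (y + t) = x + t + (y + x / y * t) := by
    field_simp
    ring
  rw [hexpand]
  exact le_add_of_nonneg_right (by positivity)

theorem div_add_mul_le_div_add_mul {u u' w c : ℝ} (hw : 0 ≤ w) (huu' : u ≤ u')
    (hu : 0 < w + c * u) (hu' : 0 < w + c * u') : u / (w + c * u) ≤ u' / (w + c * u') := by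
  rw [div_le_div_iff₀ hu hu']
  linarith [mul_le_mul_of_nonneg_right huu' hw]

section PowerRatio

variable {s τ x y n : ℝ}

theorem Gamma_add_le_Gamma_mul_rpow (hy : 0 < y) (hτ0 : 0 < τ) (hτ1 : τ < 1) :
    Real.Gamma (y + τ) ≤ Real.Gamma y * y ^ τ := by
  have hΓ := Real.Gamma_pos_of_pos hy
  have hconvex := Real.Gamma_mul_add_mul_le_rpow_Gamma_mul_rpow_Gamma hy (add_pos hy one_pos)
    (sub_pos.2 hτ1) hτ0 (by ring)
  rw [show (1 - τ) * y + τ * (y + 1) = y + τ by ring, Real.Gamma_add_one hy.ne',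
    Real.mul_rpow hy.le hΓ.le, mul_comm (y ^ τ), ← mul_assoc, ← Real.rpow_add hΓ] at hconvex
  simpa using hconvex

/-- The potential `x ^ s * Γ (y - τ) / Γ y`, a substitute for `x ^ s / y ^ τ` whose increments in
`y` are explicit. -/
noncomputable def powerRatio (s τ x y : ℝ) : ℝ :=
  x ^ s * (Real.Gamma (y - τ) / Real.Gamma y)

theorem Gamma_sub_div_Gamma_nonneg (hτ : 0 < τ) (hy : τ < y) :
    0 ≤ Real.Gamma (y - τ) / Real.Gamma y :=
  div_nonneg (Real.Gamma_pos_of_pos (sub_pos.2 hy)).le (Real.Gamma_pos_of_pos (hτ.trans hy)).le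

theorem powerRatio_nonneg (hx : 0 ≤ x) (hτ : 0 < τ) (hy : τ < y) : 0 ≤ powerRatio s τ x y :=
  mul_nonneg (Real.rpow_nonneg hx _) (Gamma_sub_div_Gamma_nonneg hτ hy)

theorem powerRatio_add_one_left_le (hs0 : 0 ≤ s) (hs1 : s ≤ 1) (hx : 0 < x) (hτ : 0 < τ)
    (hy : τ < y) : powerRatio s τ (x + 1) y ≤ powerRatio s τ x y * (1 + s / x) := by
  have hbernoulli : (1 + x⁻¹) ^ s ≤ 1 + s * x⁻¹ :=
    rpow_one_add_le_one_add_mul_self (by linarith [inv_pos.2 hx]) hs0 hs1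
  have hpow : (x + 1) ^ s ≤ x ^ s * (1 + s / x) := by
    rw [show x + 1 = x * (1 + x⁻¹) by field_simp, Real.mul_rpow hx.le (by positivity),
      div_eq_mul_inv]
    gcongr
  rw [powerRatio, powerRatio, mul_right_comm]
  exact mul_le_mul_of_nonneg_right hpow (Gamma_sub_div_Gamma_nonneg hτ hy)

theorem powerRatio_add_one_right (hτ : 0 < τ) (hy : τ < y) :
    powerRatio s τ x (y + 1) = powerRatio s τ x y * (1 - τ / y) := by
  have hy0 : 0 < y := hτ.trans hy
  have hyτ : 0 < y - τ := sub_pos.2 hy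
  have hΓ := (Real.Gamma_pos_of_pos hy0).ne'
  rw [powerRatio, powerRatio, add_sub_right_comm, Real.Gamma_add_one hyτ.ne',
    Real.Gamma_add_one hy0.ne']
  field_simp

theorem rpow_mul_rpow_neg_le_powerRatio (hx : 0 ≤ x) (hτ : 0 < τ) (hτ1 : τ < 1) (hy : τ < y) :
    x ^ s * y ^ (-τ) ≤ powerRatio s τ x y := by
  have hy0 : 0 < y := hτ.trans hy
  have hyτ : 0 < y - τ := sub_pos.2 hy
  refine mul_le_mul_of_nonneg_left ?_ (Real.rpow_nonneg hx _)
  rw [Real.rpow_neg hy0.le, ← one_div, div_le_div_iff₀ (Real.rpow_pos_of_pos hy0 _)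
    (Real.Gamma_pos_of_pos hy0), one_mul]
  calc Real.Gamma y = Real.Gamma (y - τ + τ) := by rw [sub_add_cancel]
    _ ≤ Real.Gamma (y - τ) * (y - τ) ^ τ := Gamma_add_le_Gamma_mul_rpow hyτ hτ hτ1
    _ ≤ Real.Gamma (y - τ) * y ^ τ :=
      mul_le_mul_of_nonneg_left (Real.rpow_le_rpow hyτ.le (sub_le_self y hτ.le) hτ.le)
        (Real.Gamma_pos_of_pos hyτ).le

theorem div_le_powerRatio_mul_rpow (hs1 : s ≤ 1) (hx : 0 ≤ x) (hτ : 0 < τ) (hτ1 : τ < 1)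
    (hy : τ < y) (hxn : x ≤ n) (hyn : y ≤ n) : x / n ≤ powerRatio s τ x y * n ^ (τ - s) := by
  have hy0 : 0 < y := hτ.trans hy
  have hn : 0 < n := hy0.trans_le hyn
  calc x / n ≤ (x / n) ^ s := by
        simpa using Real.rpow_le_rpow_of_exponent_ge_of_imp (by positivity)
          ((div_le_one hn).2 hxn) hs1 (fun _ h => by linarith)
    _ = x ^ s * n ^ (-τ) * n ^ (τ - s) := by
        rw [mul_assoc, ← Real.rpow_add hn, Real.div_rpow hx hn.le, div_eq_mul_inv,
          ← Real.rpow_neg hn.le, neg_add_eq_sub, sub_sub_cancel_left]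
    _ ≤ x ^ s * y ^ (-τ) * n ^ (τ - s) := by
        gcongr ?_ * ?_ * ?_
        exact Real.rpow_le_rpow_of_nonpos hy0 hyn (neg_nonpos.2 hτ.le)
    _ ≤ powerRatio s τ x y * n ^ (τ - s) := by
        gcongr
        exact rpow_mul_rpow_neg_le_powerRatio hx hτ hτ1 hy

end PowerRatio

namespace Market

section Mean

variable {N K : ℕ} {M : Market N K}

/-- The one-step expectation operator of the sales process: `transition M σ φ d` is the expected
value of `φ` after one more consumer has been shown the popularity vector `d`. -/
noncomputable def transition (M : Market N K) (σ : Equiv.Perm (Fin N)) :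
    ((Fin N → ℕ) → ℝ) →ₗ[ℝ] ((Fin N → ℕ) → ℝ) where
  toFun φ d := φ d + ∑ i, M.buyProb σ d i * (φ (d + Pi.single i 1) - φ d)
  map_add' φ ψ := by
    funext d
    simp only [Pi.add_apply, add_sub_add_comm, mul_add, Finset.sum_add_distrib]
    ring
  map_smul' c φ := by
    funext d
    simp only [Pi.smul_apply, smul_eq_mul, RingHom.id_apply, mul_add, Finset.mul_sum, ← mul_sub,
      mul_left_comm c]

theorem transition_apply (M : Market N K) (σ : Equiv.Perm (Fin N)) (φ : (Fin N → ℕ) → ℝ)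
    (d : Fin N → ℕ) :
    M.transition σ φ d = φ d + ∑ i, M.buyProb σ d i * (φ (d + Pi.single i 1) - φ d) := rfl

theorem transition_apply_eq_convex_comb (M : Market N K) (σ : Equiv.Perm (Fin N))
    (φ : (Fin N → ℕ) → ℝ) (d : Fin N → ℕ) :
    M.transition σ φ d = (1 - ∑ i, M.buyProb σ d i) * φ d +
      ∑ i, M.buyProb σ d i * φ (d + Pi.single i 1) := by
  simp only [transition_apply, mul_sub, Finset.sum_sub_distrib, ← Finset.sum_mul]
  ring

theorem transition_const (M : Market N K) (σ : Equiv.Perm (Fin N)) (c : ℝ) :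
    M.transition σ (fun _ => c) = fun _ => c := by
  funext d
  simp only [transition_apply, sub_self, mul_zero, Finset.sum_const_zero, add_zero]

theorem transition_mono (h : M.IsMMNL) (σ : Equiv.Perm (Fin N)) : Monotone (M.transition σ) := by
  intro φ ψ hφψ d
  rw [transition_apply_eq_convex_comb, transition_apply_eq_convex_comb]
  gcongr with i
  · exact sub_nonneg.2 (sum_buyProb_le_one h σ d)
  · exact hφψ d
  · exact buyProb_nonneg h σ d i
  · exact hφψ _

/-- The expectation of a function of the sales vector after `t` consumers, as a linear functional
on all real functions of the sales vector; `tsum_sales_mul_ofReal` relates it to the law `sales`. -/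
noncomputable def mean (M : Market N K) (σ : Equiv.Perm (Fin N)) :
    ℕ → ((Fin N → ℕ) → ℝ) →ₗ[ℝ] ℝ
  | 0 => LinearMap.proj 0
  | t + 1 => M.mean σ t ∘ₗ M.transition σ

theorem mean_zero (M : Market N K) (σ : Equiv.Perm (Fin N)) (φ : (Fin N → ℕ) → ℝ) :
    M.mean σ 0 φ = φ 0 := rfl

theorem mean_succ (M : Market N K) (σ : Equiv.Perm (Fin N)) (t : ℕ) (φ : (Fin N → ℕ) → ℝ) :
    M.mean σ (t + 1) φ = M.mean σ t (M.transition σ φ) := rfl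

theorem mean_const (M : Market N K) (σ : Equiv.Perm (Fin N)) (t : ℕ) (c : ℝ) :
    M.mean σ t (fun _ => c) = c := by
  induction t with
  | zero => rfl
  | succ t ih => rw [mean_succ, transition_const, ih]

theorem mean_mono (h : M.IsMMNL) (σ : Equiv.Perm (Fin N)) (t : ℕ) : Monotone (M.mean σ t) := by
  induction t with
  | zero => exact fun φ ψ hφψ => hφψ 0
  | succ t ih => exact ih.comp (transition_mono h σ)

theorem mean_nonneg (h : M.IsMMNL) (σ : Equiv.Perm (Fin N)) {φ : (Fin N → ℕ) → ℝ} (hφ : 0 ≤ φ)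
    (t : ℕ) : 0 ≤ M.mean σ t φ := by
  simpa only [map_zero] using mean_mono h σ t hφ

theorem abs_mean_le (h : M.IsMMNL) (σ : Equiv.Perm (Fin N)) (t : ℕ) (φ : (Fin N → ℕ) → ℝ) :
    |M.mean σ t φ| ≤ M.mean σ t |φ| := by
  rw [abs_le', ← map_neg]
  exact ⟨mean_mono h σ t (le_abs_self φ), mean_mono h σ t (neg_le_abs φ)⟩

theorem mean_le_pow_mul_of_transition_le (h : M.IsMMNL) (σ : Equiv.Perm (Fin N))
    {φ : (Fin N → ℕ) → ℝ} {r : ℝ} (hr : 0 ≤ r) (hφ : M.transition σ φ ≤ r • φ) (t : ℕ) :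
    M.mean σ t φ ≤ r ^ t * φ 0 := by
  induction t with
  | zero => rw [mean_zero, pow_zero, one_mul]
  | succ t ih =>
    calc M.mean σ (t + 1) φ ≤ M.mean σ t (r • φ) := mean_mono h σ t hφ
      _ = r * M.mean σ t φ := map_smul _ _ _
      _ ≤ r * (r ^ t * φ 0) := mul_le_mul_of_nonneg_left ih hr
      _ = r ^ (t + 1) * φ 0 := by ring

theorem tsum_outcome_mul_ofReal (h : M.IsMMNL) (σ : Equiv.Perm (Fin N)) (d : Fin N → ℕ)
    {φ : (Fin N → ℕ) → ℝ} (hφ : 0 ≤ φ) :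
    ∑' o, M.outcome h σ d o * ENNReal.ofReal (φ (o.elim d fun i => d + Pi.single i 1)) =
      ENNReal.ofReal (M.transition σ φ d) := by
  have hnone := sub_nonneg.2 (sum_buyProb_le_one h σ d)
  have hterm : ∀ i, 0 ≤ M.buyProb σ d i * φ (d + Pi.single i 1) := fun i =>
    mul_nonneg (buyProb_nonneg h σ d i) (hφ _)
  rw [tsum_fintype, Fintype.sum_option, transition_apply_eq_convex_comb,
    ENNReal.ofReal_add (mul_nonneg hnone (hφ d)) (Finset.sum_nonneg fun i _ => hterm i),
    ENNReal.ofReal_mul hnone, ENNReal.ofReal_sum_of_nonneg fun i _ => hterm i]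
  simp only [outcome, PMF.ofFintype_apply, Option.elim_none, Option.elim_some,
    ENNReal.ofReal_mul (buyProb_nonneg h σ d _)]

theorem tsum_sales_mul_ofReal (h : M.IsMMNL) (σ : Equiv.Perm (Fin N)) (t : ℕ)
    {φ : (Fin N → ℕ) → ℝ} (hφ : 0 ≤ φ) :
    ∑' d, M.sales h σ t d * ENNReal.ofReal (φ d) = ENNReal.ofReal (M.mean σ t φ) := by
  induction t generalizing φ with
  | zero =>
    simp only [sales, mean_zero, PMF.pure_apply, ite_mul, one_mul, zero_mul, tsum_ite_eq]
  | succ t ih =>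
    have htransition : 0 ≤ M.transition σ φ := by
      simpa only [map_zero] using transition_mono h σ hφ
    simp only [sales, tsum_bind_apply_mul, tsum_map_apply_mul, tsum_outcome_mul_ofReal h σ _ hφ,
      ih htransition, mean_succ]

theorem signalPurchaseProb_eq_mean (h : M.IsMMNL) (σ : Equiv.Perm (Fin N)) (t : ℕ) :
    M.signalPurchaseProb h σ t = M.mean σ t fun d => ∑ i, M.buyProb σ d i := by
  have hsum : (fun d => ∑ i, M.buyProb σ d i) = ∑ i, fun d => M.buyProb σ d i := by
    funext d
    rw [Finset.sum_apply]
  rw [hsum, map_sum, signalPurchaseProb]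
  refine Finset.sum_congr rfl fun i _ => ?_
  have hp : 0 ≤ fun d => M.buyProb σ d i := fun d => buyProb_nonneg h σ d i
  rw [PMF.bind_apply]
  simp only [outcome, PMF.ofFintype_apply, Option.elim_some]
  rw [tsum_sales_mul_ofReal h σ t hp, ENNReal.toReal_ofReal (mean_nonneg h σ hp t)]

theorem hasSignalLimit_of_tendsto_mean_abs (h : M.IsMMNL) (σ : Equiv.Perm (Fin N)) {L : ℝ}
    (hL : Tendsto (fun t => M.mean σ t fun d => |∑ i, M.buyProb σ d i - L|) atTop (𝓝 0)) :
    M.HasSignalLimit h σ L := by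
  rw [HasSignalLimit, tendsto_iff_dist_tendsto_zero]
  refine squeeze_zero (fun _ => dist_nonneg) (fun t => ?_) hL
  have hdiff : M.signalPurchaseProb h σ t - L =
      M.mean σ t ((fun d => ∑ i, M.buyProb σ d i) - fun _ => L) := by
    rw [map_sub, mean_const, signalPurchaseProb_eq_mean]
  rw [Real.dist_eq, hdiff]
  exact abs_mean_le h σ t _

theorem tendsto_mean_zero_of_lyapunov (h : M.IsMMNL) (σ : Equiv.Perm (Fin N)) {r : ℝ}
    {f Φ G : (Fin N → ℕ) → ℝ} (hr0 : 0 ≤ r) (hr1 : r < 1) (hf0 : 0 ≤ f) (hΦ0 : 0 ≤ Φ 0)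
    (hΦ : M.transition σ Φ ≤ Φ) (hG : M.transition σ G ≤ r • G)
    (hf : ∀ η : ℝ, 0 < η → ∃ C : ℝ, 0 ≤ C ∧ f ≤ η • Φ + C • G) :
    Tendsto (fun t => M.mean σ t f) atTop (𝓝 0) := by
  refine tendsto_order.2 ⟨fun a ha => .of_forall fun t => ha.trans_le (mean_nonneg h σ hf0 t),
    fun δ hδ => ?_⟩
  obtain ⟨C, hC, hfC⟩ := hf (δ / (Φ 0 + 1)) (by positivity)
  have hbound : ∀ t, M.mean σ t f ≤ δ / (Φ 0 + 1) * Φ 0 + C * (r ^ t * G 0) := fun t => by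
    have hΦt : M.mean σ t Φ ≤ Φ 0 := by
      simpa using mean_le_pow_mul_of_transition_le h σ zero_le_one (by rwa [one_smul]) t
    calc M.mean σ t f ≤ M.mean σ t ((δ / (Φ 0 + 1)) • Φ + C • G) := mean_mono h σ t hfC
      _ = δ / (Φ 0 + 1) * M.mean σ t Φ + C * M.mean σ t G := by
        simp only [map_add, map_smul, smul_eq_mul]
      _ ≤ δ / (Φ 0 + 1) * Φ 0 + C * (r ^ t * G 0) := by
        gcongr
        exact mean_le_pow_mul_of_transition_le h σ hr0 hG t
  have hlim : Tendsto (fun t : ℕ => δ / (Φ 0 + 1) * Φ 0 + C * (r ^ t * G 0)) atTop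
      (𝓝 (δ / (Φ 0 + 1) * Φ 0)) := by
    simpa using (((tendsto_pow_atTop_nhds_zero_of_lt_one hr0 hr1).mul_const (G 0)).const_mul
      C).const_add (δ / (Φ 0 + 1) * Φ 0)
  have hlt : δ / (Φ 0 + 1) * Φ 0 < δ := by
    rw [div_mul_eq_mul_div, div_lt_iff₀ (by positivity)]
    linarith
  filter_upwards [hlim.eventually_lt_const hlt] with t ht using (hbound t).trans_lt ht

theorem transition_half_pow_le (M : Market N K) (σ : Equiv.Perm (Fin N)) {b : ℝ}
    (hb : ∀ d, b ≤ ∑ i, M.buyProb σ d i) :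
    M.transition σ (fun d => (1 / 2 : ℝ) ^ ∑ l, d l) ≤
      (1 - b / 2) • fun d => (1 / 2 : ℝ) ^ ∑ l, d l := by
  intro d
  have hsucc : ∀ i, ∑ l, (d + Pi.single i 1 : Fin N → ℕ) l = ∑ l, d l + 1 := fun i => by
    simp only [Pi.add_apply, Finset.sum_add_distrib, Finset.sum_pi_single', Finset.mem_univ,
      if_true]
  simp only [transition_apply, hsucc, pow_succ, Pi.smul_apply, smul_eq_mul, ← Finset.sum_mul]
  linarith [mul_le_mul_of_nonneg_right (hb d) (by positivity : (0 : ℝ) ≤ (1 / 2) ^ ∑ l, d l)]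

end Mean

section Share

variable {N K : ℕ} {M : Market N K} {σ : Equiv.Perm (Fin N)} {α θ s : ℝ} {o j : Fin N}

/-- The share of item `i` in the sales vector `d`. The offset `α > 0` makes it meaningful at
`d = 0` and comparable with the probability of trying `i`. -/
noncomputable def share (α : ℝ) (d : Fin N → ℕ) (i : Fin N) : ℝ :=
  (d i + α) / ((∑ l, d l : ℕ) + α)

theorem share_nonneg (hα : 0 < α) (d : Fin N → ℕ) (i : Fin N) : 0 ≤ share α d i := by
  unfold share
  positivity

theorem cast_le_cast_sum (d : Fin N → ℕ) (i : Fin N) : (d i : ℝ) ≤ (∑ l, d l : ℕ) :=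
  Nat.cast_le.2 (Finset.single_le_sum (fun _ _ => Nat.zero_le _) (Finset.mem_univ i))

theorem share_le_one (hα : 0 < α) (d : Fin N → ℕ) (i : Fin N) : share α d i ≤ 1 :=
  div_le_one_of_le₀ (by linarith [cast_le_cast_sum d i]) (by positivity)

theorem one_le_sum_share [Nonempty (Fin N)] (hα : 0 < α) (d : Fin N → ℕ) :
    1 ≤ ∑ i, share α d i := by
  have hN : (1 : ℝ) ≤ N := by exact_mod_cast Fin.pos_iff_nonempty.2 ‹_›
  simp only [share]
  rw [← Finset.sum_div, one_le_div (by positivity), Finset.sum_add_distrib, Nat.cast_sum,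
    Finset.sum_const, Finset.card_univ, Fintype.card_fin, nsmul_eq_mul]
  gcongr
  exact le_mul_of_one_le_left hα.le hN

/-- Item `o` outgrows item `j`: relative to `d + α`, item `j` is bought at most `θ` times as often
as item `o`, whatever the popularity vector `d`. -/
def Outgrows (M : Market N K) (σ : Equiv.Perm (Fin N)) (α θ : ℝ) (o j : Fin N) : Prop :=
  ∀ d : Fin N → ℕ, M.buyProb σ d j / (d j + α) ≤ θ * (M.buyProb σ d o / (d o + α))

theorem transition_powerRatio_le (h : M.IsMMNL) (hoj : o ≠ j) (hθ0 : 0 < θ) (hθ1 : θ < 1)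
    (hs0 : 0 < s) (hs1 : s ≤ 1) (hsα : s ≤ α) (hgrow : M.Outgrows σ α θ o j) :
    M.transition σ (fun d => powerRatio s (θ * s) (d j + α) (d o + α)) ≤
      fun d => powerRatio s (θ * s) (d j + α) (d o + α) := by
  intro d
  have hα : 0 < α := hs0.trans_le hsα
  have hx : 0 < d j + α := by positivity
  have hτ : 0 < θ * s := mul_pos hθ0 hs0
  have hy : θ * s < d o + α := by
    linarith [mul_lt_of_lt_one_left hs0 hθ1, Nat.cast_nonneg (α := ℝ) (d o)]
  rw [transition_apply, Fintype.sum_eq_add o j hoj fun i hi => by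
    simp [Pi.single_eq_of_ne hi.1.symm, Pi.single_eq_of_ne hi.2.symm]]
  simp only [Pi.add_apply, Pi.single_eq_same, Pi.single_eq_of_ne hoj, Pi.single_eq_of_ne hoj.symm,
    add_zero, Nat.cast_add, Nat.cast_one]
  rw [add_right_comm (d o : ℝ), add_right_comm (d j : ℝ), powerRatio_add_one_right hτ hy]
  have hΦ := powerRatio_nonneg (s := s) hx.le hτ hy
  have hbuy_j := mul_le_mul_of_nonneg_left (powerRatio_add_one_left_le hs0.le hs1 hx hτ hy)
    (buyProb_nonneg h σ d j)
  have hdrift := mul_le_mul_of_nonneg_left (hgrow d) (mul_nonneg hΦ hs0.le)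
  set Φ := powerRatio s (θ * s) (d j + α) (d o + α)
  have hbuy_o : M.buyProb σ d o * (Φ * (1 - θ * s / (d o + α)) - Φ) =
      -(Φ * s * (θ * (M.buyProb σ d o / (d o + α)))) := by ring
  have hexpand_j : M.buyProb σ d j * (Φ * (1 + s / (d j + α))) =
      M.buyProb σ d j * Φ + Φ * s * (M.buyProb σ d j / (d j + α)) := by ring
  linarith

theorem exists_share_le_powerRatio_add (hθ0 : 0 < θ) (hθ1 : θ < 1) (hs0 : 0 < s) (hs1 : s ≤ 1)
    (hsα : s ≤ α) (o j : Fin N) {η : ℝ} (hη : 0 < η) :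
    ∃ C : ℝ, 0 ≤ C ∧ ∀ d : Fin N → ℕ, share α d j ≤
      η * powerRatio s (θ * s) (d j + α) (d o + α) + C * (1 / 2) ^ ∑ l, d l := by
  have hα : 0 < α := hs0.trans_le hsα
  have hτ : 0 < θ * s := mul_pos hθ0 hs0
  have hτs : θ * s < s := mul_lt_of_lt_one_left hs0 hθ1
  have hdecay : Tendsto (fun n : ℕ => ((n : ℝ) + α) ^ (θ * s - s)) atTop (𝓝 0) := by
    simpa only [neg_sub, Function.comp_def] using (tendsto_rpow_neg_atTop (sub_pos.2 hτs)).comp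
      (tendsto_atTop_add_const_right atTop α tendsto_natCast_atTop_atTop)
  obtain ⟨n₀, hn₀⟩ := eventually_atTop.1 (hdecay.eventually_le_const hη)
  refine ⟨2 ^ n₀, by positivity, fun d => ?_⟩
  have hy : θ * s < d o + α := by linarith [Nat.cast_nonneg (α := ℝ) (d o)]
  have hΦ := powerRatio_nonneg (s := s) (x := d j + α) (by positivity) hτ hy
  rcases le_total n₀ (∑ l, d l) with hlarge | hsmall
  · calc share α d j ≤ powerRatio s (θ * s) (d j + α) (d o + α) *
          ((∑ l, d l : ℕ) + α) ^ (θ * s - s) :=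
        div_le_powerRatio_mul_rpow hs1 (by positivity) hτ (hτs.trans_le hs1) hy
          (by linarith [cast_le_cast_sum d j]) (by linarith [cast_le_cast_sum d o])
      _ ≤ powerRatio s (θ * s) (d j + α) (d o + α) * η := by
        gcongr
        exact hn₀ _ hlarge
      _ ≤ _ := by
        rw [mul_comm]
        exact le_add_of_nonneg_right (by positivity)
  · calc share α d j ≤ 1 := share_le_one hα d j
      _ ≤ 2 ^ n₀ * (1 / 2) ^ ∑ l, d l := by
        rw [one_div, inv_pow, ← div_eq_mul_inv, one_le_div (by positivity)]
        exact pow_le_pow_right₀ one_le_two hsmall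
      _ ≤ _ := le_add_of_nonneg_left (by positivity)

theorem tendsto_mean_share_of_outgrows (h : M.IsMMNL) {b : ℝ} (hb0 : 0 < b)
    (hb : ∀ d, b ≤ ∑ i, M.buyProb σ d i) (hα : 0 < α) (hθ0 : 0 < θ) (hθ1 : θ < 1) (hoj : o ≠ j)
    (hgrow : M.Outgrows σ α θ o j) :
    Tendsto (fun t => M.mean σ t fun d => share α d j) atTop (𝓝 0) := by
  have hb1 : b ≤ 1 := (hb 0).trans (sum_buyProb_le_one h σ 0)
  have hs0 : 0 < min 1 α := lt_min one_pos hα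
  have hs1 : min 1 α ≤ 1 := min_le_left _ _
  have hsα : min 1 α ≤ α := min_le_right _ _
  refine tendsto_mean_zero_of_lyapunov h σ (r := 1 - b / 2) (by linarith) (by linarith)
    (fun d => share_nonneg hα d j) ?_ (transition_powerRatio_le h hoj hθ0 hθ1 hs0 hs1 hsα hgrow)
    (transition_half_pow_le M σ hb) fun η hη =>
      exists_share_le_powerRatio_add hθ0 hθ1 hs0 hs1 hsα o j hη
  refine powerRatio_nonneg (by positivity) (by positivity) ?_
  rw [Pi.zero_apply, Nat.cast_zero, zero_add]
  exact (mul_lt_of_lt_one_left hs0 hθ1).trans_le hsα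

end Share

section TrialConcentration

variable {N K : ℕ} {M : Market N K} {α : ℝ} {i : Fin N} {k : Fin K}

/-- The denominator of the probabilities with which a consumer of class `k` tries the items. -/
noncomputable def totalAttraction (M : Market N K) (σ : Equiv.Perm (Fin N)) (d : Fin N → ℕ)
    (k : Fin K) : ℝ :=
  ∑ j, M.v (σ j) * (M.a j k + d j) + M.z

theorem mul_add_le_totalAttraction (h : M.IsMMNL) (σ : Equiv.Perm (Fin N)) (d : Fin N → ℕ)
    (j : Fin N) (k : Fin K) : M.v (σ j) * (M.a j k + d j) ≤ M.totalAttraction σ d k := by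
  have hterm : ∀ l, 0 ≤ M.v (σ l) * (M.a l k + d l) := fun l =>
    mul_nonneg (h.v_nonneg _) (add_nonneg (h.a_nonneg _ _) (Nat.cast_nonneg _))
  exact le_add_of_le_of_nonneg (Finset.single_le_sum (fun l _ => hterm l) (Finset.mem_univ j))
    h.z_nonneg

theorem totalAttraction_pos (h : M.IsMMNL) (hv : ∀ j, 0 < M.v j) (hk : ∃ i, 0 < M.a i k)
    (σ : Equiv.Perm (Fin N)) (d : Fin N → ℕ) : 0 < M.totalAttraction σ d k := by
  obtain ⟨i, hi⟩ := hk
  exact (mul_pos (hv _) (add_pos_of_pos_of_nonneg hi (Nat.cast_nonneg _))).trans_le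
    (mul_add_le_totalAttraction h σ d i k)

theorem exists_sum_add_le_mul_totalAttraction (h : M.IsMMNL) (hv : ∀ j, 0 < M.v j)
    (hk : ∃ i, 0 < M.a i k) (hα : 0 ≤ α) (σ : Equiv.Perm (Fin N)) :
    ∃ C, ∀ d : Fin N → ℕ, ((∑ l, d l : ℕ) : ℝ) + α ≤ C * M.totalAttraction σ d k := by
  obtain ⟨i, hi⟩ := hk
  have hsold : ∀ d l, (d l : ℝ) ≤ (M.v (σ l))⁻¹ * M.totalAttraction σ d k := fun d l => by
    rw [← div_eq_inv_mul, le_div_iff₀' (hv _)]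
    exact (mul_le_mul_of_nonneg_left (le_add_of_nonneg_left (h.a_nonneg l k)) (hv _).le).trans
      (mul_add_le_totalAttraction h σ d l k)
  have hconst : ∀ d, α ≤ α / (M.v (σ i) * M.a i k) * M.totalAttraction σ d k := fun d => by
    rw [div_mul_eq_mul_div, le_div_iff₀ (mul_pos (hv _) hi)]
    gcongr
    exact (mul_le_mul_of_nonneg_left (le_add_of_nonneg_right (Nat.cast_nonneg _)) (hv _).le).trans
      (mul_add_le_totalAttraction h σ d i k)
  refine ⟨∑ l, (M.v (σ l))⁻¹ + α / (M.v (σ i) * M.a i k), fun d => ?_⟩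
  rw [add_mul, Finset.sum_mul, Nat.cast_sum]
  gcongr with l
  · exact hsold d l
  · exact hconst d

theorem exists_totalAttraction_le_mul_sum_add (h : M.IsMMNL) (hα : 0 < α)
    (σ : Equiv.Perm (Fin N)) (k : Fin K) :
    ∃ C, 0 < C ∧ ∀ d : Fin N → ℕ, M.totalAttraction σ d k ≤ C * (((∑ l, d l : ℕ) : ℝ) + α) := by
  have hV : 0 ≤ ∑ l, M.v (σ l) := Finset.sum_nonneg fun l _ => h.v_nonneg _
  have hS : 0 ≤ ∑ l, M.v (σ l) * M.a l k + M.z := add_nonneg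
    (Finset.sum_nonneg fun l _ => mul_nonneg (h.v_nonneg _) (h.a_nonneg _ _)) h.z_nonneg
  set S := ∑ l, M.v (σ l) * M.a l k + M.z with hSdef
  refine ⟨∑ l, M.v (σ l) + S / α + 1, by positivity, fun d => ?_⟩
  have hsplit : M.totalAttraction σ d k = S + ∑ l, M.v (σ l) * d l := by
    rw [totalAttraction, hSdef]
    simp only [mul_add, Finset.sum_add_distrib]
    ring
  have hsold : ∑ l, M.v (σ l) * (d l : ℝ) ≤ (∑ l, M.v (σ l)) * (∑ l, d l : ℕ) := by
    rw [Finset.sum_mul]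
    exact Finset.sum_le_sum fun l _ =>
      mul_le_mul_of_nonneg_left (cast_le_cast_sum d l) (h.v_nonneg _)
  have hexpand : (∑ l, M.v (σ l) + S / α + 1) * (((∑ l, d l : ℕ) : ℝ) + α) =
      S + (∑ l, M.v (σ l)) * (∑ l, d l : ℕ) + ((∑ l, M.v (σ l)) * α +
        S / α * (∑ l, d l : ℕ) + ((∑ l, d l : ℕ) + α)) := by
    field_simp
    ring
  rw [hsplit, hexpand]
  have hrest : 0 ≤ (∑ l, M.v (σ l)) * α + S / α * (∑ l, d l : ℕ) + ((∑ l, d l : ℕ) + α) := by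
    positivity
  linarith

theorem exists_tryProb_le_mul_share (h : M.IsMMNL) (hv : ∀ j, 0 < M.v j)
    (hk : ∃ i, 0 < M.a i k) (hα : 0 < α) (σ : Equiv.Perm (Fin N)) (i : Fin N) :
    ∃ C, ∀ d : Fin N → ℕ, M.tryProb σ d i k ≤ C * share α d i := by
  obtain ⟨C, hbound⟩ := exists_sum_add_le_mul_totalAttraction h hv hk hα.le σ
  refine ⟨M.v (σ i) * (1 + M.a i k / α) * C, fun d => ?_⟩
  have hT := totalAttraction_pos h hv hk σ d
  have hvi := hv (σ i)
  have hai := h.a_nonneg i k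
  calc M.tryProb σ d i k = M.v (σ i) * (M.a i k + d i) / M.totalAttraction σ d k := rfl
    _ ≤ M.v (σ i) * ((1 + M.a i k / α) * (α + d i)) / M.totalAttraction σ d k := by
      gcongr
      exact add_le_one_add_div_mul_add hai hα (Nat.cast_nonneg _)
    _ ≤ M.v (σ i) * ((1 + M.a i k / α) * (α + d i)) * (C / ((∑ l, d l : ℕ) + α)) := by
      rw [div_eq_mul_inv]
      gcongr
      rw [inv_eq_one_div, div_le_div_iff₀ hT (by positivity), one_mul]
      exact hbound d
    _ = M.v (σ i) * (1 + M.a i k / α) * C * share α d i := by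
      rw [share]
      ring

theorem exists_mul_share_le_tryProb (h : M.IsMMNL) (hv : ∀ j, 0 < M.v j) (hik : 0 < M.a i k)
    (hα : 0 < α) (σ : Equiv.Perm (Fin N)) :
    ∃ c, 0 < c ∧ ∀ d : Fin N → ℕ, c * share α d i ≤ M.tryProb σ d i k := by
  obtain ⟨C, hC, hbound⟩ := exists_totalAttraction_le_mul_sum_add h hα σ k
  have hvi := hv (σ i)
  refine ⟨M.v (σ i) / ((1 + α / M.a i k) * C), by positivity, fun d => ?_⟩
  have hT := totalAttraction_pos h hv ⟨i, hik⟩ σ d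
  calc M.v (σ i) / ((1 + α / M.a i k) * C) * share α d i
      = M.v (σ i) * ((α + d i) / (1 + α / M.a i k)) / (C * ((∑ l, d l : ℕ) + α)) := by
        rw [share]
        field_simp
        ring
    _ ≤ M.v (σ i) * (M.a i k + d i) / M.totalAttraction σ d k := by
        gcongr
        · rw [div_le_iff₀' (by positivity)]
          exact add_le_one_add_div_mul_add hα.le hik (Nat.cast_nonneg _)
        · exact hbound d
    _ = M.tryProb σ d i k := rfl

theorem exists_le_sum_buyProb [Nonempty (Fin N)] (h : M.IsMMNL) (hv : ∀ j, 0 < M.v j)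
    (hwanted : ∀ i, ∃ k, 0 < M.a i k ∧ 0 < M.q i k) (σ : Equiv.Perm (Fin N)) :
    ∃ b, 0 < b ∧ ∀ d, b ≤ ∑ i, M.buyProb σ d i := by
  have hitem : ∀ i, ∃ c, 0 < c ∧ ∀ d : Fin N → ℕ, c * share 1 d i ≤ M.buyProb σ d i := fun i => by
    obtain ⟨k, hak, hqk⟩ := hwanted i
    obtain ⟨c, hc, hshare⟩ := exists_mul_share_le_tryProb h hv hak one_pos σ
    have hwk := h.w_pos k
    refine ⟨M.w k * (c * M.q i k), by positivity, fun d => ?_⟩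
    calc M.w k * (c * M.q i k) * share 1 d i = M.w k * (c * share 1 d i * M.q i k) := by ring
      _ ≤ M.w k * (M.tryProb σ d i k * M.q i k) := by
        gcongr
        exact hshare d
      _ ≤ M.buyProb σ d i := Finset.single_le_sum
        (f := fun l => M.w l * (M.tryProb σ d i l * M.q i l)) (fun l _ => mul_nonneg (h.w_pos l).le
          (mul_nonneg (tryProb_nonneg h σ d i l) (h.q_nonneg i l))) (Finset.mem_univ k)
  choose c hc hshare using hitem
  obtain ⟨i₀, hmin⟩ := Finite.exists_min c
  refine ⟨c i₀, hc i₀, fun d => ?_⟩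
  calc c i₀ ≤ c i₀ * ∑ i, share 1 d i :=
        le_mul_of_one_le_right (hc i₀).le (one_le_sum_share one_pos d)
    _ = ∑ i, c i₀ * share 1 d i := Finset.mul_sum _ _ _
    _ ≤ ∑ i, M.buyProb σ d i := Finset.sum_le_sum fun i _ =>
        (mul_le_mul_of_nonneg_right (hmin i) (share_nonneg one_pos d i)).trans (hshare i d)

theorem sum_tryProb_eq_one {σ : Equiv.Perm (Fin N)} {d : Fin N → ℕ} (hz : M.z = 0)
    (hT : M.totalAttraction σ d k ≠ 0) : ∑ i, M.tryProb σ d i k = 1 := by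
  simp only [totalAttraction, hz, add_zero] at hT
  simp only [tryProb, hz, add_zero]
  rw [← Finset.sum_div, div_self hT]

theorem abs_sum_buyProb_sub_avgQuality_le (h : M.IsMMNL) (hz : M.z = 0)
    {σ : Equiv.Perm (Fin N)} {d : Fin N → ℕ} (hT : ∀ k, M.totalAttraction σ d k ≠ 0)
    (o : Fin N) :
    |∑ i, M.buyProb σ d i - M.avgQuality o| ≤
      ∑ i ∈ Finset.univ.erase o, ∑ k, M.w k * M.tryProb σ d i k := by
  have hdiff : ∑ i, M.buyProb σ d i - M.avgQuality o =
      ∑ i, ∑ k, M.w k * M.tryProb σ d i k * (M.q i k - M.q o k) := by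
    have havg : M.avgQuality o = ∑ i, ∑ k, M.w k * M.tryProb σ d i k * M.q o k := by
      rw [Finset.sum_comm]
      simp only [← Finset.sum_mul, ← Finset.mul_sum, sum_tryProb_eq_one hz (hT _), mul_one,
        avgQuality]
    simp only [havg, buyProb, ← Finset.sum_sub_distrib, mul_sub, mul_assoc]
  have hself : ∑ k, M.w k * M.tryProb σ d o k * (M.q o k - M.q o k) = 0 := by
    simp only [sub_self, mul_zero, Finset.sum_const_zero]
  rw [hdiff, ← Finset.sum_erase
    (f := fun i => ∑ k, M.w k * M.tryProb σ d i k * (M.q i k - M.q o k)) Finset.univ hself]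
  refine (Finset.abs_sum_le_sum_abs _ _).trans (Finset.sum_le_sum fun i _ =>
    (Finset.abs_sum_le_sum_abs _ _).trans (Finset.sum_le_sum fun k _ => ?_))
  have hwt : 0 ≤ M.w k * M.tryProb σ d i k :=
    mul_nonneg (h.w_pos k).le (tryProb_nonneg h σ d i k)
  rw [abs_mul, abs_of_nonneg hwt]
  exact mul_le_of_le_one_right hwt (abs_sub_le_iff.2
    ⟨by linarith [h.q_le_one i k, h.q_nonneg o k], by linarith [h.q_le_one o k, h.q_nonneg i k]⟩)

theorem hasSignalLimit_avgQuality_of_outgrows (h : M.IsMMNL) (hv : ∀ j, 0 < M.v j)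
    (hz : M.z = 0) (hattract : ∀ k, ∃ i, 0 < M.a i k)
    (hwanted : ∀ i, ∃ k, 0 < M.a i k ∧ 0 < M.q i k) {σ : Equiv.Perm (Fin N)} {θ : ℝ} {o : Fin N}
    (hα : 0 < α) (hθ0 : 0 < θ) (hθ1 : θ < 1) (hgrow : ∀ j, o ≠ j → M.Outgrows σ α θ o j) :
    M.HasSignalLimit h σ (M.avgQuality o) := by
  have : Nonempty (Fin N) := ⟨o⟩
  obtain ⟨b, hb0, hb⟩ := exists_le_sum_buyProb h hv hwanted σ
  have htry : ∀ i ∈ Finset.univ.erase o, ∀ k,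
      Tendsto (fun t => M.mean σ t fun d => M.tryProb σ d i k) atTop (𝓝 0) := fun i hi k => by
    obtain ⟨C, hC⟩ := exists_tryProb_le_mul_share h hv (hattract k) hα σ i
    have hshare := tendsto_mean_share_of_outgrows h hb0 hb hα hθ0 hθ1
      (Finset.ne_of_mem_erase hi).symm (hgrow i (Finset.ne_of_mem_erase hi).symm)
    refine squeeze_zero (mean_nonneg h σ fun d => tryProb_nonneg h σ d i k)
      (fun t => ?_) (by simpa only [mul_zero] using hshare.const_mul C)
    exact (mean_mono h σ t hC).trans_eq (map_smul (M.mean σ t) C fun d => share α d i)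
  have hothers : Tendsto (fun t => ∑ i ∈ Finset.univ.erase o, ∑ k,
      M.w k * M.mean σ t fun d => M.tryProb σ d i k) atTop (𝓝 0) := by
    simpa only [mul_zero, Finset.sum_const_zero] using
      tendsto_finsetSum (Finset.univ.erase o) fun i hi =>
        tendsto_finsetSum Finset.univ fun k _ => (htry i hi k).const_mul (M.w k)
  refine hasSignalLimit_of_tendsto_mean_abs h σ
    (squeeze_zero (mean_nonneg h σ fun d => abs_nonneg _) (fun t => ?_) hothers)
  calc M.mean σ t (fun d => |∑ i, M.buyProb σ d i - M.avgQuality o|)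
      ≤ M.mean σ t (∑ i ∈ Finset.univ.erase o, ∑ k, M.w k • fun d => M.tryProb σ d i k) :=
        mean_mono h σ t fun d => by
          simpa only [Finset.sum_apply, Pi.smul_apply, smul_eq_mul] using
            abs_sum_buyProb_sub_avgQuality_le h hz
              (fun k => (totalAttraction_pos h hv (hattract k) σ d).ne') o
    _ = _ := by simp only [map_sum, map_smul, smul_eq_mul]

end TrialConcentration

section Diagonal

variable {K : ℕ} {v : Fin K → ℝ} {ε α β : ℝ}

/-- The appeal matrix with diagonal entries `α` and all other entries `β`. -/
def diagAppeal (K : ℕ) (α β : ℝ) : Fin K → Fin K → ℝ := fun i k => if i = k then α else β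

theorem diagAppeal_self (α β : ℝ) (i : Fin K) : diagAppeal K α β i i = α := if_pos rfl

/-- The diagonal entries of the quality matrix of `diagonal`. -/
def diagQuality (ε : ℝ) (i : Fin K) : ℝ := if i.val = 0 then 1 else 1 - ε

theorem diagQuality_zero [NeZero K] (ε : ℝ) : diagQuality ε (0 : Fin K) = 1 := if_pos rfl

theorem diagQuality_of_ne_zero [NeZero K] {i : Fin K} (hi : i ≠ 0) (ε : ℝ) :
    diagQuality ε i = 1 - ε :=
  if_neg (Fin.val_ne_zero_iff.2 hi)

theorem diagQuality_pos (hε : ε < 1) (i : Fin K) : 0 < diagQuality ε i := by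
  unfold diagQuality
  split_ifs <;> linarith

theorem diagQuality_le_one (hε : 0 ≤ ε) (i : Fin K) : diagQuality ε i ≤ 1 := by
  unfold diagQuality
  split_ifs <;> linarith

theorem diagonal_q_apply (v : Fin K → ℝ) (ε : ℝ) (a : Fin K → Fin K → ℝ) (i k : Fin K) :
    (diagonal v ε a).q i k = if i = k then diagQuality ε i else 0 := rfl

theorem isMMNL_diagonal [NeZero K] (hv : Antitone v) (hv0 : ∀ j, 0 ≤ v j) (hε0 : 0 ≤ ε)
    (hε1 : ε < 1) {a : Fin K → Fin K → ℝ} (ha : ∀ i k, 0 ≤ a i k) :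
    (diagonal v ε a).IsMMNL where
  v_nonneg := hv0
  v_antitone := hv
  a_nonneg := ha
  q_nonneg i k := by
    rw [diagonal_q_apply]
    split_ifs
    exacts [(diagQuality_pos hε1 i).le, le_rfl]
  q_le_one i k := by
    rw [diagonal_q_apply]
    split_ifs
    exacts [diagQuality_le_one hε0 i, zero_le_one]
  w_pos _ := one_div_pos.2 (Nat.cast_pos'.2 (NeZero.pos K))
  w_sum := by simp [diagonal, NeZero.ne K]
  z_nonneg := le_rfl

theorem avgQuality_diagonal (v : Fin K → ℝ) (ε : ℝ) (a : Fin K → Fin K → ℝ) (i : Fin K) :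
    (diagonal v ε a).avgQuality i = diagQuality ε i / K := by
  simp only [avgQuality, diagonal_q_apply, mul_ite, mul_zero, Finset.sum_ite_eq, Finset.mem_univ,
    if_true]
  exact one_div_mul_eq_div _ _

theorem avgQuality_diagonal_zero [NeZero K] (v : Fin K → ℝ) (ε : ℝ) (a : Fin K → Fin K → ℝ) :
    (diagonal v ε a).avgQuality 0 = 1 / K := by
  rw [avgQuality_diagonal, diagQuality_zero]

theorem maxAvgQuality_diagonal [NeZero K] (v : Fin K → ℝ) (hε : 0 ≤ ε)
    (a : Fin K → Fin K → ℝ) : (diagonal v ε a).maxAvgQuality = 1 / K := by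
  have hgreatest : IsGreatest (Set.range (diagonal v ε a).avgQuality) (1 / K) := by
    refine ⟨⟨0, avgQuality_diagonal_zero v ε a⟩, ?_⟩
    rintro _ ⟨i, rfl⟩
    rw [avgQuality_diagonal]
    gcongr
    exact diagQuality_le_one hε i
  exact hgreatest.csSup_eq

theorem maxAvgQuality_diagonal_pos [NeZero K] (v : Fin K → ℝ) (hε : 0 ≤ ε)
    (a : Fin K → Fin K → ℝ) : 0 < (diagonal v ε a).maxAvgQuality := by
  rw [maxAvgQuality_diagonal v hε]
  exact one_div_pos.2 (Nat.cast_pos'.2 (NeZero.pos K))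

theorem visibility_le_of_isAvgQualityRanking [NeZero K] (hv : Antitone v) (hε : 0 < ε)
    {a : Fin K → Fin K → ℝ} {σ : Equiv.Perm (Fin K)}
    (hσ : (diagonal v ε a).IsAvgQualityRanking σ) (j : Fin K) : v (σ j) ≤ v (σ 0) := by
  refine hv (not_lt.1 fun hlt => ?_)
  have hj : j ≠ 0 := by
    rintro rfl
    exact lt_irrefl _ hlt
  have hquality := hσ j 0 hlt
  rw [avgQuality_diagonal, avgQuality_diagonal,
    div_le_div_iff_of_pos_right (Nat.cast_pos'.2 (NeZero.pos K)), diagQuality_zero,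
    diagQuality_of_ne_zero hj] at hquality
  linarith

theorem sum_mul_diagAppeal_add (u : Fin K → ℝ) (α β : ℝ) (d : Fin K → ℕ) (i : Fin K) :
    ∑ j, u j * (diagAppeal K α β j i + d j) =
      ∑ j, u j * d j + β * ∑ j, u j + (α - β) * u i := by
  have hterm : ∀ j, u j * (diagAppeal K α β j i + d j) =
      u j * d j + β * u j + if j = i then (α - β) * u j else 0 := fun j => by
    unfold diagAppeal
    split_ifs <;> ring
  simp only [hterm, Finset.sum_add_distrib, Finset.sum_ite_eq', Finset.mem_univ, if_true,
    Finset.mul_sum]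

theorem buyProb_diagonal_diagAppeal (v : Fin K → ℝ) (ε α β : ℝ) (σ : Equiv.Perm (Fin K))
    (d : Fin K → ℕ) (i : Fin K) :
    (diagonal v ε (diagAppeal K α β)).buyProb σ d i =
      diagQuality ε i / K *
        (v (σ i) * (α + d i) / (∑ j, v (σ j) * d j + β * ∑ j, v j + (α - β) * v (σ i))) := by
  simp only [buyProb, diagonal_q_apply, mul_ite, mul_zero, Finset.sum_ite_eq, Finset.mem_univ,
    if_true]
  simp only [tryProb, diagonal, diagAppeal_self, sum_mul_diagAppeal_add (fun j => v (σ j)),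
    Equiv.sum_comp σ v, add_zero]
  ring

theorem outgrows_diagonal_diagAppeal [NeZero K] (hvpos : ∀ j, 0 < v j) (hε : ε ≤ 1)
    (hα : 0 < α) (hβ : 0 ≤ β) {σ : Equiv.Perm (Fin K)} {j : Fin K} (hj : 0 ≠ j)
    (hvj : v (σ j) ≤ v (σ 0)) :
    (diagonal v ε (diagAppeal K α β)).Outgrows σ α (1 - ε) 0 j := by
  intro d
  set W := ∑ l, v (σ l) * d l + β * ∑ l, v l with hWdef
  have hrate : ∀ i, (diagonal v ε (diagAppeal K α β)).buyProb σ d i / (d i + α) =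
      diagQuality ε i / K * (v (σ i) / (W + (α - β) * v (σ i))) := fun i => by
    have hi : (d i : ℝ) + α ≠ 0 := by positivity
    rw [buyProb_diagonal_diagAppeal, ← hWdef, add_comm α]
    field_simp
  have hsold : 0 ≤ ∑ l, v (σ l) * (d l : ℝ) :=
    Finset.sum_nonneg fun l _ => mul_nonneg (hvpos _).le (Nat.cast_nonneg _)
  have hle : ∀ i, v (σ i) ≤ ∑ l, v l := fun i =>
    Finset.single_le_sum (fun l _ => (hvpos l).le) (Finset.mem_univ (σ i))
  have hW : 0 ≤ W := add_nonneg hsold (mul_nonneg hβ ((hvpos _).le.trans (hle 0)))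
  have hpos : ∀ i, 0 < W + (α - β) * v (σ i) := fun i => by
    linarith [mul_le_mul_of_nonneg_left (hle i) hβ, mul_pos hα (hvpos (σ i))]
  rw [hrate, hrate, diagQuality_zero, diagQuality_of_ne_zero hj.symm, ← mul_assoc, mul_one_div]
  exact mul_le_mul_of_nonneg_left (div_add_mul_le_div_add_mul hW hvj (hpos j) (hpos 0))
    (div_nonneg (sub_nonneg.2 hε) (Nat.cast_nonneg K))

theorem hasSignalLimit_diagonal_diagAppeal [NeZero K] (hv : Antitone v) (hvpos : ∀ j, 0 < v j)
    (hε : ε ∈ Set.Ioo (0 : ℝ) 1) (hα : 0 < α) (hβ : 0 ≤ β)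
    (h : (diagonal v ε (diagAppeal K α β)).IsMMNL) {σ : Equiv.Perm (Fin K)}
    (hσ : (diagonal v ε (diagAppeal K α β)).IsAvgQualityRanking σ) :
    (diagonal v ε (diagAppeal K α β)).HasSignalLimit h σ
      (diagonal v ε (diagAppeal K α β)).maxAvgQuality := by
  have happeal : ∀ i, 0 < (diagonal v ε (diagAppeal K α β)).a i i := fun i =>
    hα.trans_eq (diagAppeal_self α β i).symm
  have hquality : ∀ i, 0 < (diagonal v ε (diagAppeal K α β)).q i i := fun i => by
    rw [diagonal_q_apply, if_pos rfl]
    exact diagQuality_pos hε.2 i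
  rw [maxAvgQuality_diagonal v hε.1.le, ← avgQuality_diagonal_zero v ε (diagAppeal K α β)]
  exact hasSignalLimit_avgQuality_of_outgrows h hvpos rfl (fun k => ⟨k, happeal k⟩)
    (fun i => ⟨i, happeal i, hquality i⟩) hα (sub_pos.2 hε.2) (sub_lt_self 1 hε.1) fun j hj =>
      outgrows_diagonal_diagAppeal hvpos hε.2.le hα hβ hj
        (visibility_le_of_isAvgQualityRanking hv hε.1 hσ j)

theorem diagAppeal_nonneg (hα : 0 ≤ α) (hβ : 0 ≤ β) (i k : Fin K) : 0 ≤ diagAppeal K α β i k := by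
  unfold diagAppeal
  split_ifs <;> assumption

theorem diagAppeal_pos (hα : 0 < α) (hβ : 0 < β) (i k : Fin K) : 0 < diagAppeal K α β i k := by
  unfold diagAppeal
  split_ifs <;> assumption

theorem noSignalPurchaseProb_div_maxAvgQuality [NeZero K] (v : Fin K → ℝ) (hε : 0 ≤ ε)
    (α β : ℝ) (σ : Equiv.Perm (Fin K)) :
    (diagonal v ε (diagAppeal K α β)).noSignalPurchaseProb σ /
        (diagonal v ε (diagAppeal K α β)).maxAvgQuality =
      ∑ i, diagQuality ε i * (v (σ i) * α / (β * ∑ j, v j + (α - β) * v (σ i))) := by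
  have hK : (K : ℝ) ≠ 0 := Nat.cast_ne_zero.2 (NeZero.ne K)
  rw [maxAvgQuality_diagonal v hε, noSignalPurchaseProb, Finset.sum_div]
  refine Finset.sum_congr rfl fun i _ => ?_
  simp only [buyProb_diagonal_diagAppeal, Pi.zero_apply, Nat.cast_zero, mul_zero,
    Finset.sum_const_zero, zero_add, add_zero]
  field_simp

theorem tendsto_ratio_of_offDiag_tendsto_zero [NeZero K] (hvpos : ∀ j, 0 < v j) (hα : α ≠ 0)
    {b : ℝ → ℝ} (hb : Tendsto b (𝓝[>] 0) (𝓝 0)) (σ : Equiv.Perm (Fin K)) :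
    Tendsto (fun ε : ℝ => (diagonal v ε (diagAppeal K α (b ε))).noSignalPurchaseProb σ /
      (diagonal v ε (diagAppeal K α (b ε))).maxAvgQuality) (𝓝[>] 0) (𝓝 (K : ℝ)) := by
  have hquality : ∀ i : Fin K, Tendsto (fun ε => diagQuality ε i) (𝓝[>] 0) (𝓝 1) := fun i => by
    have hcont : Continuous fun ε => diagQuality ε i := by
      unfold diagQuality
      split_ifs <;> fun_prop
    have hzero : diagQuality 0 i = 1 := by simp [diagQuality]
    exact (hcont.tendsto' 0 1 hzero).mono_left nhdsWithin_le_nhds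
  have htrial : ∀ i, Tendsto
      (fun ε => v (σ i) * α / (b ε * ∑ j, v j + (α - b ε) * v (σ i))) (𝓝[>] 0) (𝓝 1) := fun i => by
    have hne : v (σ i) * α ≠ 0 := mul_ne_zero (hvpos _).ne' hα
    have hdenom : Tendsto (fun ε => b ε * ∑ j, v j + (α - b ε) * v (σ i)) (𝓝[>] 0)
        (𝓝 (v (σ i) * α)) := by
      simpa [mul_comm] using (hb.mul_const (∑ j, v j)).add ((hb.const_sub α).mul_const (v (σ i)))
    exact div_self hne ▸ tendsto_const_nhds.div hdenom hne
  have hsum : Tendsto (fun ε => ∑ i, diagQuality ε i *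
      (v (σ i) * α / (b ε * ∑ j, v j + (α - b ε) * v (σ i)))) (𝓝[>] 0) (𝓝 (K : ℝ)) := by
    simpa using tendsto_finsetSum Finset.univ fun i _ => (hquality i).mul (htrial i)
  refine hsum.congr' ?_
  filter_upwards [self_mem_nhdsWithin] with ε (hε : 0 < ε)
  rw [noSignalPurchaseProb_div_maxAvgQuality v hε.le]

theorem exists_forall_lt_ratio [NeZero K] (hvpos : ∀ j, 0 < v j) {r : ℝ} (hr : r < K) :
    ∃ ε ∈ Set.Ioo (0 : ℝ) 1, ∀ σ : Equiv.Perm (Fin K),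
      r < (diagonal v ε (diagAppeal K 1 ε)).noSignalPurchaseProb σ /
        (diagonal v ε (diagAppeal K 1 ε)).maxAvgQuality := by
  have hratio := eventually_all.2 fun σ : Equiv.Perm (Fin K) =>
    (tendsto_ratio_of_offDiag_tendsto_zero hvpos one_ne_zero
      (tendsto_id.mono_left nhdsWithin_le_nhds) σ).eventually_const_lt hr
  obtain ⟨ε, hrε, hε⟩ := (hratio.and (Ioo_mem_nhdsGT one_pos)).exists
  exact ⟨ε, hε, hrε⟩

theorem tendsto_ratio_of_diag_tendsto_zero [NeZero K] [Nontrivial (Fin K)] (hvpos : ∀ j, 0 < v j)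
    (hε : 0 ≤ ε) (hβ : β ≠ 0) (σ : Equiv.Perm (Fin K)) :
    Tendsto (fun α : ℝ => (diagonal v ε (diagAppeal K α β)).noSignalPurchaseProb σ /
      (diagonal v ε (diagAppeal K α β)).maxAvgQuality) (𝓝 0) (𝓝 0) := by
  simp only [noSignalPurchaseProb_div_maxAvgQuality v hε]
  have hrest : ∀ i, β * ∑ j, v j + (0 - β) * v i ≠ 0 := fun i => by
    obtain ⟨j, hj⟩ := exists_ne i
    have hpos : 0 < ∑ l ∈ Finset.univ.erase i, v l := Finset.sum_pos (fun l _ => hvpos l)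
      ⟨j, Finset.mem_erase.2 ⟨hj, Finset.mem_univ j⟩⟩
    rw [← Finset.add_sum_erase _ _ (Finset.mem_univ i), mul_add, zero_sub, neg_mul,
      add_neg_cancel_comm]
    exact mul_ne_zero hβ hpos.ne'
  have hcont : ContinuousAt (fun α => ∑ i, diagQuality ε i *
      (v (σ i) * α / (β * ∑ j, v j + (α - β) * v (σ i)))) 0 := by
    refine tendsto_finsetSum _ fun i _ => ?_
    have hi := hrest (σ i)
    exact ContinuousAt.tendsto (by fun_prop (disch := assumption))
  simpa using hcont.tendsto

end Diagonal

end Market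

theorem mainTheorem6 (K : ℕ) (hK : 1 ≤ K) (v : Fin K → ℝ) (hv : Antitone v)
    (hvpos : ∀ j, 0 < v j) :
    -- upper bound `K`: identity appeals, `ε → 0`
    (∀ σ : ℝ → Equiv.Perm (Fin K),
      (∀ ε ∈ Set.Ioo (0 : ℝ) 1,
        (Market.diagonal v ε (Market.idAppeal K)).IsAvgQualityRanking (σ ε)) →
      (∀ ε ∈ Set.Ioo (0 : ℝ) 1,
        0 < (Market.diagonal v ε (Market.idAppeal K)).maxAvgQuality ∧
        ∃ h : (Market.diagonal v ε (Market.idAppeal K)).IsMMNL,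
          (Market.diagonal v ε (Market.idAppeal K)).HasSignalLimit h (σ ε)
            (Market.diagonal v ε (Market.idAppeal K)).maxAvgQuality) ∧
      Tendsto (fun ε : ℝ =>
          (Market.diagonal v ε (Market.idAppeal K)).noSignalPurchaseProb (σ ε) /
            (Market.diagonal v ε (Market.idAppeal K)).maxAvgQuality)
        (𝓝[>] 0) (𝓝 (K : ℝ))) ∧
    -- upper bound `K` within the models whose appeals are all strictly positive
    (∀ r : ℝ, r < K → ∃ ε ∈ Set.Ioo (0 : ℝ) 1, ∃ a : Fin K → Fin K → ℝ,
      (Market.diagonal v ε a).PositiveAppeals ∧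
      0 < (Market.diagonal v ε a).maxAvgQuality ∧
      ∃ h : (Market.diagonal v ε a).IsMMNL, ∀ σ : Equiv.Perm (Fin K),
        (Market.diagonal v ε a).IsAvgQualityRanking σ →
          (Market.diagonal v ε a).HasSignalLimit h σ (Market.diagonal v ε a).maxAvgQuality ∧
          r < (Market.diagonal v ε a).noSignalPurchaseProb σ /
            (Market.diagonal v ε a).maxAvgQuality) ∧
    -- lower bound `0`: small diagonal appeals `α → 0`
    (2 ≤ K → ∀ ε ∈ Set.Ioo (0 : ℝ) 1, ∀ σ : ℝ → Equiv.Perm (Fin K),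
      (∀ α : ℝ, 0 < α →
        (Market.diagonal v ε (Market.smallDiagAppeal K α)).IsAvgQualityRanking (σ α)) →
      (∀ α : ℝ, 0 < α →
        (Market.diagonal v ε (Market.smallDiagAppeal K α)).PositiveAppeals ∧
        0 < (Market.diagonal v ε (Market.smallDiagAppeal K α)).maxAvgQuality ∧
        ∃ h : (Market.diagonal v ε (Market.smallDiagAppeal K α)).IsMMNL,
          (Market.diagonal v ε (Market.smallDiagAppeal K α)).HasSignalLimit h (σ α)
            (Market.diagonal v ε (Market.smallDiagAppeal K α)).maxAvgQuality) ∧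
      Tendsto (fun α : ℝ =>
          (Market.diagonal v ε (Market.smallDiagAppeal K α)).noSignalPurchaseProb (σ α) /
            (Market.diagonal v ε (Market.smallDiagAppeal K α)).maxAvgQuality)
        (𝓝[>] 0) (𝓝 0)) := by
  have : NeZero K := ⟨Nat.one_le_iff_ne_zero.1 hK⟩
  have hmmnl {ε α β : ℝ} (hε : ε ∈ Set.Ioo (0 : ℝ) 1) (hα : 0 < α) (hβ : 0 ≤ β) :
      (Market.diagonal v ε (Market.diagAppeal K α β)).IsMMNL :=
    Market.isMMNL_diagonal hv (fun j => (hvpos j).le) hε.1.le hε.2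
      (Market.diagAppeal_nonneg hα.le hβ)
  have hlimit {ε α β : ℝ} {σ : Equiv.Perm (Fin K)} (hε : ε ∈ Set.Ioo (0 : ℝ) 1) (hα : 0 < α)
      (hβ : 0 ≤ β) :=
    Market.hasSignalLimit_diagonal_diagAppeal (σ := σ) hv hvpos hε hα hβ (hmmnl hε hα hβ)
  have hmax {ε : ℝ} (hε : ε ∈ Set.Ioo (0 : ℝ) 1) := Market.maxAvgQuality_diagonal_pos v hε.1.le
  refine ⟨fun σ hσ => ⟨fun ε hε => ?_, ?_⟩, fun r hr => ?_,
    fun hK2 ε hε σ hσ => ⟨fun α hα => ?_, ?_⟩⟩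
  · exact ⟨hmax hε _, hmmnl hε one_pos le_rfl, hlimit hε one_pos le_rfl (hσ ε hε)⟩
  · exact tendsto_apply_of_forall_tendsto (Market.tendsto_ratio_of_offDiag_tendsto_zero hvpos
      one_ne_zero tendsto_const_nhds) σ
  · obtain ⟨ε, hε, hratio⟩ := Market.exists_forall_lt_ratio hvpos hr
    exact ⟨ε, hε, Market.diagAppeal K 1 ε, Market.diagAppeal_pos one_pos hε.1, hmax hε _,
      hmmnl hε one_pos hε.1.le, fun σ hσ => ⟨hlimit hε one_pos hε.1.le hσ, hratio σ⟩⟩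
  · exact ⟨Market.diagAppeal_pos hα one_pos, hmax hε _, hmmnl hε hα zero_le_one,
      hlimit hε hα zero_le_one (hσ α hα)⟩
  · have : Nontrivial (Fin K) := Fin.nontrivial_iff_two_le.2 hK2
    exact tendsto_apply_of_forall_tendsto (fun σ₀ => (Market.tendsto_ratio_of_diag_tendsto_zero
      hvpos hε.1.le one_ne_zero σ₀).mono_left nhdsWithin_le_nhds) σ
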